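/- Consider the quartic focusing half-wave equation in one space dimension $$i\,\partial_t u=\sqrt{-\Delta}\,u-u|u|^{3},\qquad (t,x)\in\mathbb R\times\mathbb R,$$ where $\sqrt{-\Delta}$ is the Fourier multiplier $\mathcal F(\sqrt{-\Delta}f)(\xi)=|\xi|\,\mathcal F(f)(\xi)$ (with $\mathcal F f(\xi)=\int f(x)e^{-ix\xi}\,dx$), and the equation is understood weakly in $x$: for every Schwartz function $\varphi$ on $\mathbb R$ and every $t\in\mathbb R$, $$i\,\frac{d}{dt}\int_{\mathbb R}u(t,x)\varphi(x)\,dx=\int_{\mathbb R}u(t,x)\,(\sqrt{-\Delta}\,\varphi)(x)\,dx-\int_{\mathbb R}u(t,x)|u(t,x)|^{3}\varphi(x)\,dx .$$ Then for no $\omega\in\mathbb R$ does there exist a function $Q_1\in H^{1/2}(\mathbb R)$, $Q_1\neq 0$, such that the wave moving at the speed of light $$u(t,x)=e^{i\omega t}\,Q_1(x-t)$$ is a solution of this equation. -/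

import Mathlib

open MeasureTheory FourierTransform SchwartzMap

namespace HalfWave

/-- The half-wave operator `√(-Δ)` on Schwartz functions of one real variable: the Fourier
multiplier with symbol `|2πξ|` for the normalization `𝓕 φ ξ = ∫ x, exp (-2πi x ξ) * φ x`, in which
`-Δ` has the symbol `(2πξ)²`. -/
noncomputable def sqrtNegLaplacian (φ : 𝓢(ℝ, ℂ)) : ℝ → ℂ :=
  𝓕⁻ (fun ξ : ℝ => ((|2 * Real.pi * ξ| : ℝ) : ℂ) * (𝓕 φ) ξ)

/-- `u` (time first, space second) is a weak solution of the quartic focusing half-wave equation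
`i ∂ₜ u = √(-Δ) u - u |u|³` on `ℝ × ℝ`: for every Schwartz test function `φ` of the space variable
and every time `t`, the function `s ↦ i ⟨u(s), φ⟩` is differentiable at `t`, with derivative
`⟨u(t), √(-Δ) φ⟩ - ⟨u(t) |u(t)|³, φ⟩`. Here `⟨f, φ⟩ = ∫ f φ` is the bilinear pairing, for which
`√(-Δ)` is symmetric, its symbol being even. For `u(t) ∈ H^{1/2}(ℝ)` all the integrals converge
absolutely. -/
def IsWeakSolution (u : ℝ → ℝ → ℂ) : Prop :=
  ∀ (φ : 𝓢(ℝ, ℂ)) (t : ℝ),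
    HasDerivAt (fun s : ℝ => Complex.I * ∫ x : ℝ, u s x * φ x)
      ((∫ x : ℝ, u t x * sqrtNegLaplacian φ x) -
        ∫ x : ℝ, u t x * ((‖u t x‖ ^ 3 : ℝ) : ℂ) * φ x) t

/-- The wave with profile `Q` and frequency `ω` that moves with velocity `v`:
`u(t, x) = exp (i ω t) Q(x - v t)`. -/
noncomputable def travelingWave (ω v : ℝ) (Q : ℝ → ℂ) : ℝ → ℝ → ℂ :=
  fun t x => Complex.exp (Complex.I * ω * t) * Q (x - v * t)

/-- Membership of an `L²` function in the Sobolev space `H^{1/2}(ℝ)`. -/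
def MemHHalf (Q : Lp ℂ 2 (volume : Measure ℝ)) : Prop :=
  TemperedDistribution.MemSobolev (1 / 2 : ℝ) 2 (Lp.toTemperedDistribution Q)

end HalfWave

/-! At the speed of light the profile satisfies `Q|Q|³ - ωQ = (√(-Δ) + i∂ₓ)Q`, and the operator on
the right has symbol `4π max(-ξ, 0)`: it kills positive frequencies. The left side is `W = rQ` with
`r = |Q|³ - ω` real. Being a multiplication by a real function, it satisfies `⟨Q, eₛW⟩ = ⟨W, eₛQ⟩`
for every modulation `eₛ`. On the Fourier side this says that the difference quotient of `max(-ξ,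
0)` with step `s`, integrated against `conj q(ξ) q(ξ - s)` with `q = 𝓕 Q`, gives zero. As `s → 0+`
the quotient becomes the indicator of `ξ < 0`, so `q` vanishes there (`fourier_eq_zero_of_neg`).
Hence `W = 0` and `|Q|³ = ω` wherever `Q ≠ 0` (`nonlinearity_eq`).

It remains to exclude a modulus with values in `{0, c}` (`eq_zero_of_norm_eq`). For such `Q`,
`c‖|Q(· + h)| - |Q|‖₁ ≤ ‖Q(· + h) - Q‖₂²`, which is `o(h)` in `H^{1/2}`. Cutting a unit translation
into `n` equal ones shows that `|Q|` is 1-periodic, and a periodic function in `L²(ℝ)` is zero.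

For the pairings to make sense in `L²`, `Q|Q|³` must be square integrable; this is the embedding of
`H^{1/2}` into `L⁸` (`memLp_eight`). -/

namespace HalfWave

/-! ### The Fourier transform on `L²`, by duality with Schwartz functions -/

/-- Two locally integrable functions that agree as tempered distributions agree almost everywhere. -/
theorem ae_eq_of_integral_mul_schwartz_eq {f g : ℝ → ℂ} (hf : LocallyIntegrable f)
    (hg : LocallyIntegrable g)
    (h : ∀ ψ : 𝓢(ℝ, ℂ), ∫ x, f x * ψ x = ∫ x, g x * ψ x) : f =ᵐ[volume] g := by
  apply ae_eq_of_integral_contDiff_smul_eq hf hg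
  intro φ hφ hc
  have hg₁ : HasCompactSupport (Complex.ofRealCLM ∘ φ) := hc.comp_left rfl
  have hg₂ : ContDiff ℝ (⊤ : ℕ∞) (Complex.ofRealCLM ∘ φ) := by fun_prop
  simpa [mul_comm] using h (hg₁.toSchwartzMap hg₂)

theorem integral_fourier_mul (Q : Lp ℂ 2 (volume : Measure ℝ)) (ψ : 𝓢(ℝ, ℂ)) :
    ∫ x, (𝓕 Q : Lp ℂ 2 (volume : Measure ℝ)) x * ψ x = ∫ x, Q x * (𝓕 ψ) x := by
  have := congrArg (fun T => T ψ) (Lp.fourier_toTemperedDistribution_eq Q)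
  simpa [TemperedDistribution.fourier_apply, mul_comm] using this.symm

theorem integral_fourierInv_mul (Q : Lp ℂ 2 (volume : Measure ℝ)) (ψ : 𝓢(ℝ, ℂ)) :
    ∫ x, (𝓕⁻ Q : Lp ℂ 2 (volume : Measure ℝ)) x * ψ x = ∫ x, Q x * (𝓕⁻ ψ) x := by
  have := congrArg (fun T => T ψ) (Lp.fourierInv_toTemperedDistribution_eq Q)
  simpa [TemperedDistribution.fourierInv_apply, mul_comm] using this.symm

theorem locallyIntegrable_coeFn (Q : Lp ℂ 2 (volume : Measure ℝ)) : LocallyIntegrable Q :=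
  (Lp.memLp Q).locallyIntegrable (by norm_num)

theorem fourier_comp_add_right (f : ℝ → ℂ) (s x : ℝ) :
    𝓕 (fun v => f (v + s)) x = ((Real.fourierChar (s * x) : Circle) : ℂ) * 𝓕 f x := by
  have := congrFun (VectorFourier.fourierIntegral_comp_add_right (𝕜 := ℝ) Real.fourierChar volume
    (innerₗ ℝ) f s) x
  rw [mul_comm s x]
  simpa [Real.fourier_eq, VectorFourier.fourierIntegral, Circle.smul_def] using this

/-- Modulation becomes translation on the Fourier side. -/
theorem fourier_modulation {Q G : Lp ℂ 2 (volume : Measure ℝ)} {s : ℝ}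
    (hG : G =ᵐ[volume] fun x => ((Real.fourierChar (s * x) : Circle) : ℂ) * Q x) :
    (𝓕 G : Lp ℂ 2 (volume : Measure ℝ)) =ᵐ[volume]
      fun ξ => (𝓕 Q : Lp ℂ 2 (volume : Measure ℝ)) (ξ - s) := by
  have hsub := (Lp.memLp (𝓕 Q : Lp ℂ 2 (volume : Measure ℝ))).comp_measurePreserving
    (measurePreserving_sub_right volume s)
  apply ae_eq_of_integral_mul_schwartz_eq (locallyIntegrable_coeFn _)
    (hsub.locallyIntegrable (by norm_num))
  intro ψ
  let χ : 𝓢(ℝ, ℂ) := compSubConstCLM ℂ (-s) ψ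
  have hχ : ∀ x, χ x = ψ (x + s) := fun x => by simp [χ]
  have hχF : ∀ x, (𝓕 χ) x = ((Real.fourierChar (s * x) : Circle) : ℂ) * (𝓕 ψ) x := fun x => by
    rw [fourier_coe, fourier_coe, ← fourier_comp_add_right]
    exact congrFun (congrArg 𝓕 (funext hχ)) x
  calc ∫ x, (𝓕 G : Lp ℂ 2 (volume : Measure ℝ)) x * ψ x
      = ∫ x, G x * (𝓕 ψ) x := integral_fourier_mul _ _
    _ = ∫ x, Q x * (𝓕 χ) x := by
      apply integral_congr_ae
      filter_upwards [hG] with x hx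
      rw [hx, hχF]; ring
    _ = ∫ x, (𝓕 Q : Lp ℂ 2 (volume : Measure ℝ)) x * χ x := (integral_fourier_mul _ _).symm
    _ = ∫ x, (𝓕 Q : Lp ℂ 2 (volume : Measure ℝ)) (x - s) * χ (x - s) :=
      (integral_sub_right_eq_self (fun x => (𝓕 Q : Lp ℂ 2 (volume : Measure ℝ)) x * χ x) s).symm
    _ = _ := by simp [hχ]

theorem memLp_fourierChar_mul (f : Lp ℂ 2 (volume : Measure ℝ)) (s : ℝ) :
    MemLp (fun x => ((Real.fourierChar (s * x) : Circle) : ℂ) * f x) 2 := by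
  refine (Lp.memLp f).of_le ?_ ?_
  · exact (Continuous.aestronglyMeasurable (by fun_prop)).mul (Lp.aestronglyMeasurable _)
  · filter_upwards with x; rw [norm_mul, Circle.norm_coe, one_mul]

/-- Translation becomes modulation on the Fourier side. -/
theorem fourier_translation {Q G : Lp ℂ 2 (volume : Measure ℝ)} {h : ℝ}
    (hG : G =ᵐ[volume] fun x => Q (x + h)) :
    (𝓕 G : Lp ℂ 2 (volume : Measure ℝ)) =ᵐ[volume]
      fun ξ => ((Real.fourierChar (h * ξ) : Circle) : ℂ) * (𝓕 Q : Lp ℂ 2 (volume : Measure ℝ)) ξ := by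
  have hmul := memLp_fourierChar_mul (𝓕 Q : Lp ℂ 2 (volume : Measure ℝ)) h
  apply ae_eq_of_integral_mul_schwartz_eq (locallyIntegrable_coeFn _)
    (hmul.locallyIntegrable (by norm_num))
  intro ψ
  let χ : 𝓢(ℝ, ℂ) := 𝓕⁻ (compSubConstCLM ℂ h (𝓕 ψ))
  have hχF : ∀ x, (𝓕 χ) x = (𝓕 ψ) (x - h) := fun x => by simp [χ]
  have hχ : ∀ x, χ x = ((Real.fourierChar (h * x) : Circle) : ℂ) * ψ x := fun x => by
    have h1 : (𝓕⁻ (𝓕 ψ)) x = ψ x := by simp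
    rw [← h1]
    simp only [χ]
    rw [fourierInv_coe, fourierInv_coe, Real.fourierInv_eq_fourier_neg,
      Real.fourierInv_eq_fourier_neg]
    have := fourier_comp_add_right ((𝓕 ψ : 𝓢(ℝ, ℂ)) : ℝ → ℂ) (-h) (-x)
    rw [neg_mul_neg] at this
    rw [← this]
    have hsub : ((compSubConstCLM ℂ h (𝓕 ψ) : 𝓢(ℝ, ℂ)) : ℝ → ℂ) =
        fun v => (𝓕 ψ : 𝓢(ℝ, ℂ)) (v + -h) := funext fun y => by simp [sub_eq_add_neg]
    rw [hsub]
  calc ∫ x, (𝓕 G : Lp ℂ 2 (volume : Measure ℝ)) x * ψ x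
      = ∫ x, G x * (𝓕 ψ) x := integral_fourier_mul _ _
    _ = ∫ x, Q (x + h) * (𝓕 χ) (x + h) := by
      apply integral_congr_ae
      filter_upwards [hG] with x hx
      rw [hx, hχF]; simp
    _ = ∫ x, Q x * (𝓕 χ) x :=
      integral_add_right_eq_self (fun x => Q x * (𝓕 χ) x) h
    _ = ∫ x, (𝓕 Q : Lp ℂ 2 (volume : Measure ℝ)) x * χ x := (integral_fourier_mul _ _).symm
    _ = _ := by
      apply integral_congr_ae
      filter_upwards with x
      simp only [hχ]; ring

/-- On `L¹ ∩ L²` the inverse Fourier transform of `L²` is given by the Fourier integral. -/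
theorem fourierInv_ae_eq_of_integrable (f : Lp ℂ 2 (volume : Measure ℝ)) (hf : Integrable f) :
    (𝓕⁻ f : Lp ℂ 2 (volume : Measure ℝ)) =ᵐ[volume] 𝓕⁻ (f : ℝ → ℂ) := by
  have hcont : Continuous (𝓕⁻ (f : ℝ → ℂ)) := by
    have : Continuous (𝓕 (f : ℝ → ℂ)) :=
      VectorFourier.fourierIntegral_continuous Real.continuous_fourierChar (by fun_prop) hf
    have h2 : 𝓕⁻ (f : ℝ → ℂ) = fun x => 𝓕 (f : ℝ → ℂ) (-x) := by
      funext x; exact Real.fourierInv_eq_fourier_neg _ _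
    rw [h2]; fun_prop
  apply ae_eq_of_integral_mul_schwartz_eq (locallyIntegrable_coeFn _) hcont.locallyIntegrable
  intro ψ
  rw [integral_fourierInv_mul]
  have := VectorFourier.integral_bilin_fourierIntegral_eq_flip (ContinuousLinearMap.mul ℂ ℂ)
    (L := -innerₗ ℝ) (μ := volume) (ν := volume) (e := Real.fourierChar)
    Real.continuous_fourierChar (by fun_prop) hf (g := ψ) ψ.integrable
  have key : ∀ (g : ℝ → ℂ) x, VectorFourier.fourierIntegral Real.fourierChar volume (-innerₗ ℝ) g x
      = 𝓕⁻ g x := fun g x => by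
    simp [VectorFourier.fourierIntegral, Real.fourierInv_eq]
  have key2 : ∀ (g : ℝ → ℂ) x, VectorFourier.fourierIntegral Real.fourierChar volume
      (-innerₗ ℝ).flip g x = 𝓕⁻ g x := fun g x => by
    simp [VectorFourier.fourierIntegral, Real.fourierInv_eq, mul_comm]
  simp only [ContinuousLinearMap.mul_apply', key, key2] at this
  rw [this, fourierInv_coe]

/-! ### The embedding of `H^{1/2}(ℝ)` into `L⁸` -/

theorem memLp_weight_mul_fourier {Q : Lp ℂ 2 (volume : Measure ℝ)} (hQ : MemHHalf Q) :
    MemLp (fun ξ : ℝ => (((1 + ξ ^ 2) ^ (1 / 4 : ℝ) : ℝ) : ℂ) *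
      (𝓕 Q : Lp ℂ 2 (volume : Measure ℝ)) ξ) 2 := by
  obtain ⟨f, hf⟩ := TemperedDistribution.memSobolev_iff_exists_smulLeftCLM_fourier.1 hQ
  have hgt : (fun x : ℝ => (((1 + ‖x‖ ^ 2) ^ ((1 / 2 : ℝ) / 2) : ℝ) : ℂ)).HasTemperateGrowth := by
    fun_prop
  refine (memLp_congr_ae ?_).1 (Lp.memLp f)
  have hloc : LocallyIntegrable (fun ξ : ℝ => (((1 + ξ ^ 2) ^ (1 / 4 : ℝ) : ℝ) : ℂ) *
      (𝓕 Q : Lp ℂ 2 (volume : Measure ℝ)) ξ) := by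
    have hc : Continuous (fun ξ : ℝ => (((1 + ξ ^ 2) ^ (1 / 4 : ℝ) : ℝ) : ℂ)) := by
      refine Complex.continuous_ofReal.comp ?_
      exact Continuous.rpow_const (by fun_prop) (fun x => Or.inl (by positivity))
    rw [← locallyIntegrableOn_univ]
    exact (locallyIntegrableOn_univ.2 (locallyIntegrable_coeFn _)).continuousOn_mul
      hc.continuousOn isOpen_univ.isLocallyClosed
  apply ae_eq_of_integral_mul_schwartz_eq (locallyIntegrable_coeFn _) hloc
  intro ψ
  have h1 := congrArg (fun T => T ψ) hf
  rw [Lp.fourier_toTemperedDistribution_eq] at h1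
  simp only [TemperedDistribution.smulLeftCLM_apply_apply, Lp.toTemperedDistribution_apply,
    smulLeftCLM_apply_apply hgt, smul_eq_mul] at h1
  have e : (1 / 2 : ℝ) / 2 = 1 / 4 := by norm_num
  rw [e] at h1
  simp only [mul_comm (f _)]
  rw [← h1]
  apply integral_congr_ae
  filter_upwards with x
  simp only [Real.norm_eq_abs, sq_abs]
  ring

theorem norm_sq_eq_integral (f : Lp ℂ 2 (volume : Measure ℝ)) : ‖f‖ ^ 2 = ∫ x, ‖f x‖ ^ 2 := by
  have h : ((‖f‖ ^ 2 : ℝ) : ℂ) = ((∫ x, ‖f x‖ ^ 2 : ℝ) : ℂ) := by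
    have := inner_self_eq_norm_sq_to_K (𝕜 := ℂ) f
    rw [L2.inner_def] at this
    push_cast
    rw [← integral_complex_ofReal]
    simp only [inner_self_eq_norm_sq_to_K] at this
    simpa using this.symm
  exact_mod_cast h

/-- Chebyshev's inequality in `L²`. -/
theorem measure_le_norm_le (f : Lp ℂ 2 (volume : Measure ℝ)) {ε : ℝ} (hε : 0 < ε) :
    volume {x | ε ≤ ‖f x‖} ≤ ENNReal.ofReal (‖f‖ ^ 2 / ε ^ 2) := by
  have h := meas_ge_le_mul_pow_eLpNorm_enorm (volume : Measure ℝ) (p := 2) (by norm_num) (by norm_num)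
    (Lp.aestronglyMeasurable f) (ε := ENNReal.ofReal ε) (by simpa using hε) (by simp)
  have h1 : eLpNorm f 2 volume = ENNReal.ofReal ‖f‖ := by
    rw [Lp.norm_def, ENNReal.ofReal_toReal (Lp.eLpNorm_ne_top f)]
  rw [h1] at h
  refine le_trans (measure_mono fun x hx => ?_) (h.trans (le_of_eq ?_))
  · simp only [Set.mem_ofPred_eq] at hx ⊢
    rw [← ofReal_norm]
    exact ENNReal.ofReal_le_ofReal hx
  · rw [← ENNReal.ofReal_inv_of_pos hε]
    rw [ENNReal.toReal_ofNat, ENNReal.rpow_ofNat, ENNReal.rpow_ofNat,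
      ← ENNReal.ofReal_pow (by positivity), ← ENNReal.ofReal_pow (by positivity),
      ← ENNReal.ofReal_mul (by positivity)]
    congr 1
    field_simp

theorem norm_fourierInv_le_integral_norm (f : ℝ → ℂ) (x : ℝ) : ‖𝓕⁻ f x‖ ≤ ∫ ξ, ‖f ξ‖ := by
  rw [Real.fourierInv_eq_fourier_neg, Real.fourier_eq]
  refine (norm_integral_le_integral_norm _).trans (le_of_eq ?_)
  simp only [Circle.norm_smul]

/-- The weight `(1 + ξ²)^(1/24)`, of which `(1 + ξ²)^(1/4)` is the sixth power. -/
noncomputable def weight (ξ : ℝ) : ℝ := (1 + ξ ^ 2) ^ (1 / 24 : ℝ)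

theorem weight_pos (ξ : ℝ) : 0 < weight ξ := by unfold weight; positivity

theorem continuous_weight : Continuous weight :=
  Continuous.rpow_const (by fun_prop) (fun x => Or.inl (by positivity))

theorem weight_pow_six (ξ : ℝ) : weight ξ ^ 6 = (1 + ξ ^ 2) ^ (1 / 4 : ℝ) := by
  unfold weight
  rw [← Real.rpow_mul_natCast (by positivity)]
  norm_num

/-- The square is `(1 + ξ²)^(-7/12)`, integrable because `7/6 > 1`. The exponent 1/24 in the weight
leaves this margin while keeping all later powers integral. -/
theorem memLp_weight_inv_pow_seven : MemLp (fun ξ => (weight ξ ^ 7)⁻¹) 2 := by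
  have hc : Continuous fun ξ => (weight ξ ^ 7)⁻¹ :=
    (continuous_weight.pow 7).inv₀ fun ξ => (pow_pos (weight_pos ξ) 7).ne'
  rw [memLp_two_iff_integrable_sq hc.aestronglyMeasurable]
  have := integrable_rpow_neg_one_add_norm_sq (E := ℝ) (μ := volume) (r := 7 / 6) (by norm_num)
  refine this.congr (Filter.Eventually.of_forall fun ξ => ?_)
  simp only [weight, Real.norm_eq_abs, sq_abs]
  rw [← inv_pow, ← Real.rpow_neg (by positivity), ← Real.rpow_mul_natCast (by positivity),
    ← Real.rpow_mul_natCast (by positivity)]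
  norm_num

/-- The level sets of a function in `H^{1/2}(ℝ)` decay like those of a function in weak `L¹⁴`. -/
theorem exists_measure_lt_norm_le {Q : Lp ℂ 2 (volume : Measure ℝ)} (hQ : MemHHalf Q) :
    ∃ C : ℝ, ∀ t : ℝ, 0 < t → volume {x | t < ‖Q x‖} ≤ ENNReal.ofReal (C / t ^ 14) := by
  set q : Lp ℂ 2 (volume : Measure ℝ) := 𝓕 Q with hq
  have hg : MemLp (fun ξ => ((weight ξ ^ 6 : ℝ) : ℂ) * q ξ) 2 := by
    simpa only [weight_pow_six] using memLp_weight_mul_fourier hQ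
  have hgn : MemLp (fun ξ => weight ξ ^ 6 * ‖q ξ‖) 2 := by
    refine hg.norm.congr_norm ?_ ?_
    · exact ((continuous_weight.pow 6).aestronglyMeasurable).mul (Lp.aestronglyMeasurable _).norm
    · filter_upwards with ξ
      have := (weight_pos ξ).le
      simp
  have hI : Integrable fun ξ => (weight ξ ^ 7)⁻¹ * (weight ξ ^ 6 * ‖q ξ‖) :=
    memLp_weight_inv_pow_seven.integrable_mul hgn
  have hI2 : Integrable fun ξ => (weight ξ ^ 6 * ‖q ξ‖) ^ 2 :=
    (memLp_two_iff_integrable_sq hgn.1).1 hgn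
  -- The added 1 keeps `C₀` positive, so that it can be divided by.
  set C₀ := (∫ ξ, (weight ξ ^ 7)⁻¹ * (weight ξ ^ 6 * ‖q ξ‖)) + 1 with hC₀
  have hnn : ∀ ξ, 0 ≤ (weight ξ ^ 7)⁻¹ * (weight ξ ^ 6 * ‖q ξ‖) := fun ξ => by
    have := weight_pos ξ
    positivity
  have hC₀pos : 0 < C₀ := add_pos_of_nonneg_of_pos (integral_nonneg hnn) one_pos
  set K := ∫ ξ, (weight ξ ^ 6 * ‖q ξ‖) ^ 2 with hK
  refine ⟨2 ^ 14 * C₀ ^ 12 * K, fun t ht => ?_⟩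
  -- Frequencies are cut at weight `B`, chosen so that the low part is at most `B * C₀ = t / 2` in
  -- sup norm; where `‖Q‖ > t` the high part must then exceed `t / 2`.
  set B := t / (2 * C₀) with hB
  have hBpos : 0 < B := by positivity
  have hS : MeasurableSet {ξ | weight ξ ≤ B} :=
    measurableSet_le continuous_weight.measurable measurable_const
  set S := {ξ | weight ξ ≤ B} with hSdef
  have hlo : MemLp (S.indicator q) 2 := (Lp.memLp q).indicator hS
  set lo := hlo.toLp _ with hlodef
  have hloae : lo =ᵐ[volume] S.indicator q := hlo.coeFn_toLp
  have hbound : ∀ ξ, ‖S.indicator q ξ‖ ≤ B * ((weight ξ ^ 7)⁻¹ * (weight ξ ^ 6 * ‖q ξ‖)) := by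
    intro ξ
    have hw := weight_pos ξ
    by_cases h : ξ ∈ S
    · rw [Set.indicator_of_mem h]
      have h' : weight ξ ≤ B := h
      have : (weight ξ ^ 7)⁻¹ * (weight ξ ^ 6 * ‖q ξ‖) = ‖q ξ‖ / weight ξ := by field_simp
      rw [this, mul_div_assoc', le_div_iff₀ hw, mul_comm]
      gcongr
    · rw [Set.indicator_of_notMem h, norm_zero]
      exact mul_nonneg hBpos.le (hnn ξ)
  have hloint : Integrable lo :=
    ((hI.const_mul B).mono' hlo.1 (Filter.Eventually.of_forall hbound)).congr hloae.symm
  have hlosup : ∀ x, ‖𝓕⁻ (lo : ℝ → ℂ) x‖ ≤ t / 2 := by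
    intro x
    have h1 : ‖𝓕⁻ (lo : ℝ → ℂ) x‖ ≤ ∫ ξ, ‖lo ξ‖ := norm_fourierInv_le_integral_norm _ x
    have h2 : ∫ ξ, ‖lo ξ‖ ≤ ∫ ξ, B * ((weight ξ ^ 7)⁻¹ * (weight ξ ^ 6 * ‖q ξ‖)) := by
      refine integral_mono_ae hloint.norm (hI.const_mul B) ?_
      filter_upwards [hloae] with ξ hξ
      rw [hξ]; exact hbound ξ
    rw [integral_const_mul] at h2
    have h3 : B * (∫ ξ, (weight ξ ^ 7)⁻¹ * (weight ξ ^ 6 * ‖q ξ‖)) ≤ B * C₀ := by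
      gcongr; simp [hC₀]
    have h4 : B * C₀ = t / 2 := by rw [hB]; field_simp
    linarith
  -- Off `S` the weight exceeds `B`, so its twelfth power in `K` yields `B ^ 12`. With the `t ^ 2`
  -- of Chebyshev this gives the decay `t ^ (-14)`.
  have hhi : ‖q - lo‖ ^ 2 ≤ K / B ^ 12 := by
    rw [norm_sq_eq_integral, hK, ← integral_div]
    have hi2 : Integrable fun ξ => ‖(q - lo) ξ‖ ^ 2 := by
      have := Lp.memLp (q - lo)
      exact (memLp_two_iff_integrable_sq_norm this.1).1 this
    apply integral_mono_ae hi2 (hI2.div_const _)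
    filter_upwards [hloae, Lp.coeFn_sub q lo] with ξ h1 h2
    rw [h2, Pi.sub_apply, h1]
    have hw := weight_pos ξ
    by_cases h : ξ ∈ S
    · rw [Set.indicator_of_mem h]
      rw [sub_self, norm_zero, zero_pow two_ne_zero]
      exact div_nonneg (sq_nonneg _) (pow_nonneg hBpos.le _)
    · rw [Set.indicator_of_notMem h, sub_zero]
      have h' : B < weight ξ := not_le.1 h
      rw [le_div_iff₀ (by positivity), mul_pow, ← pow_mul, mul_comm]
      gcongr
  have hsplit : Q = 𝓕⁻ lo + 𝓕⁻ (q - lo) := by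
    rw [← fourierInv_add]
    simp [hq]
  have hae : ∀ᵐ x, ‖Q x‖ ≤ t / 2 + ‖(𝓕⁻ (q - lo) : Lp ℂ 2 (volume : Measure ℝ)) x‖ := by
    filter_upwards [fourierInv_ae_eq_of_integrable lo hloint,
      Lp.coeFn_add (𝓕⁻ lo) (𝓕⁻ (q - lo))] with x h1 h2
    rw [← hsplit] at h2
    rw [h2, Pi.add_apply, h1]
    exact (norm_add_le _ _).trans (by gcongr; exact hlosup x)
  have hmono : volume {x | t < ‖Q x‖} ≤
      volume {x | t / 2 ≤ ‖(𝓕⁻ (q - lo) : Lp ℂ 2 (volume : Measure ℝ)) x‖} := by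
    apply measure_mono_ae
    filter_upwards [hae] with x hx h
    have h' : t < ‖Q x‖ := h
    show t / 2 ≤ _
    linarith
  refine hmono.trans ((measure_le_norm_le _ (by positivity)).trans (ENNReal.ofReal_le_ofReal ?_))
  have hn : ‖(𝓕⁻ (q - lo) : Lp ℂ 2 (volume : Measure ℝ))‖ = ‖q - lo‖ :=
    (Lp.fourierTransformₗᵢ ℝ ℂ).symm.norm_map _
  rw [hn]
  calc ‖q - lo‖ ^ 2 / (t / 2) ^ 2 ≤ K / B ^ 12 / (t / 2) ^ 2 := by gcongr
    _ = _ := by rw [hB]; field_simp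

/-- Layer-cake formula: the integrand is the level-set measure times `t ^ 7`. Chebyshev in `L²`
makes it bounded for `t ≤ 1`, and the weak `L¹⁴` bound makes it `O(t ^ (-7))` for `t > 1`. -/
theorem memLp_eight {Q : Lp ℂ 2 (volume : Measure ℝ)} (hQ : MemHHalf Q) :
    MemLp Q 8 := by
  refine ⟨Lp.aestronglyMeasurable Q, ?_⟩
  obtain ⟨C, hC⟩ := exists_measure_lt_norm_le hQ
  rw [eLpNorm_lt_top_iff_lintegral_rpow_enorm_lt_top (by norm_num) (by norm_num)]
  have hlayer := lintegral_rpow_eq_lintegral_meas_lt_mul (volume : Measure ℝ) (f := fun x => ‖Q x‖)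
    (Filter.Eventually.of_forall fun x => norm_nonneg _)
    (Lp.aestronglyMeasurable Q).norm.aemeasurable (p := 8) (by norm_num)
  have he : ∫⁻ x, ‖Q x‖ₑ ^ (8 : ENNReal).toReal = ∫⁻ x, ENNReal.ofReal (‖Q x‖ ^ (8 : ℝ)) := by
    apply lintegral_congr
    intro x
    rw [← ENNReal.ofReal_rpow_of_nonneg (norm_nonneg _) (by norm_num), ofReal_norm]
    norm_num
  rw [he, hlayer]
  refine ENNReal.mul_lt_top ENNReal.ofReal_lt_top ?_
  rw [← Set.Ioc_union_Ioi_eq_Ioi (zero_le_one' ℝ),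
    lintegral_union measurableSet_Ioi (Set.Ioc_disjoint_Ioi le_rfl)]
  refine ENNReal.add_lt_top.2 ⟨?_, ?_⟩
  · calc ∫⁻ t in Set.Ioc (0 : ℝ) 1, volume {a | t < ‖Q a‖} * ENNReal.ofReal (t ^ ((8 : ℝ) - 1))
        ≤ ∫⁻ t in Set.Ioc (0 : ℝ) 1, ENNReal.ofReal (‖Q‖ ^ 2) := by
          apply setLIntegral_mono measurable_const
          intro t ht
          have h1 : volume {a | t < ‖Q a‖} ≤ ENNReal.ofReal (‖Q‖ ^ 2 / t ^ 2) :=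
            (measure_mono fun x (hx : t < ‖Q x‖) => (le_of_lt hx : t ≤ ‖Q x‖)).trans
              (measure_le_norm_le Q ht.1)
          refine (mul_le_mul_left h1 _).trans ?_
          rw [← ENNReal.ofReal_mul (by positivity)]
          apply ENNReal.ofReal_le_ofReal
          have h7 : t ^ ((8 : ℝ) - 1) = t ^ 7 := by norm_num
          rw [h7]
          have ht0 := ht.1
          have : ‖Q‖ ^ 2 / t ^ 2 * t ^ 7 = ‖Q‖ ^ 2 * t ^ 5 := by field_simp
          rw [this]
          exact mul_le_of_le_one_right (by positivity) (pow_le_one₀ ht0.le ht.2)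
      _ < ⊤ := by simp
  · have hint : IntegrableOn (fun t : ℝ => C * t ^ (-7 : ℝ)) (Set.Ioi 1) :=
      (integrableOn_Ioi_rpow_of_lt (by norm_num) one_pos).const_mul C
    refine lt_of_le_of_lt ?_ hint.lintegral_lt_top
    apply setLIntegral_mono_ae hint.aestronglyMeasurable.aemeasurable.ennreal_ofReal
    filter_upwards with t ht
    have ht0 : (0 : ℝ) < t := lt_trans one_pos ht
    refine (mul_le_mul_left (hC t ht0) _).trans ?_
    rw [← ENNReal.ofReal_mul' (by positivity)]
    apply ENNReal.ofReal_le_ofReal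
    have h7 : t ^ ((8 : ℝ) - 1) = t ^ 7 := by norm_num
    have h7' : t ^ (-7 : ℝ) = (t ^ 7)⁻¹ := by
      rw [Real.rpow_neg ht0.le]; norm_num
    rw [h7, h7']
    apply le_of_eq
    field_simp

/-- The nonlinearity `Q |Q|³` of a function `Q` in `H^{1/2}(ℝ)` is square integrable. -/
theorem memLp_nonlinearity {Q : Lp ℂ 2 (volume : Measure ℝ)} (hQ : MemHHalf Q) :
    MemLp (fun x => Q x * ((‖Q x‖ ^ 3 : ℝ) : ℂ)) 2 := by
  have h8 := memLp_eight hQ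
  have hm : AEStronglyMeasurable (fun x => Q x * ((‖Q x‖ ^ 3 : ℝ) : ℂ)) volume :=
    (Lp.aestronglyMeasurable Q).mul
      (Complex.continuous_ofReal.comp_aestronglyMeasurable ((Lp.aestronglyMeasurable Q).norm.pow 3))
  rw [memLp_two_iff_integrable_sq_norm hm]
  have := h8.integrable_norm_pow (p := 8) (by norm_num)
  refine this.congr (Filter.Eventually.of_forall fun x => ?_)
  simp
  ring

/-! ### The profile equation in weak form -/

theorem integrable_coeFn_mul {f : ℝ → ℂ} (hf : MemLp f 2) (φ : 𝓢(ℝ, ℂ)) :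
    Integrable fun x => f x * φ x :=
  hf.integrable_mul (φ.memLp 2)

/-- Uniformity in small translations provides the dominating function for differentiating `∫ Q(x)
φ(x + s)` in `s`. -/
theorem exists_norm_schwartz_add_le (φ : 𝓢(ℝ, ℂ)) :
    ∃ C : ℝ, ∀ s ∈ Set.Ioo (-1 : ℝ) 1, ∀ x, ‖φ (x + s)‖ ≤ C * (1 + x ^ 2)⁻¹ := by
  set A := SchwartzMap.seminorm ℝ 0 0 φ
  set B := SchwartzMap.seminorm ℝ 2 0 φ
  refine ⟨3 * (A + B), fun s hs x => ?_⟩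
  have h0 : ‖φ (x + s)‖ ≤ A := norm_le_seminorm ℝ φ (x + s)
  have h2 : ‖x + s‖ ^ 2 * ‖φ (x + s)‖ ≤ B := norm_pow_mul_le_seminorm ℝ φ 2 (x + s)
  rw [Real.norm_eq_abs, sq_abs] at h2
  rw [← div_eq_mul_inv, le_div_iff₀ (by positivity)]
  have hs2 : s ^ 2 ≤ 1 := by nlinarith [hs.1, hs.2]
  have hx : 1 + x ^ 2 ≤ 3 + 3 * (x + s) ^ 2 := by nlinarith [sq_nonneg (2 * x + 3 * s)]
  calc ‖φ (x + s)‖ * (1 + x ^ 2) ≤ ‖φ (x + s)‖ * (3 + 3 * (x + s) ^ 2) := by gcongr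
    _ = 3 * (‖φ (x + s)‖ + (x + s) ^ 2 * ‖φ (x + s)‖) := by ring
    _ ≤ _ := by gcongr

theorem memLp_inv_one_add_sq : MemLp (fun x : ℝ => (1 + x ^ 2)⁻¹) 2 := by
  have hm : AEStronglyMeasurable (fun x : ℝ => (1 + x ^ 2)⁻¹) volume :=
    integrable_inv_one_add_sq.aestronglyMeasurable
  rw [memLp_two_iff_integrable_sq hm]
  refine integrable_inv_one_add_sq.mono' (hm.pow 2) (Filter.Eventually.of_forall fun x => ?_)
  have h1 : (1 + x ^ 2)⁻¹ ≤ 1 := inv_le_one_of_one_le₀ (by nlinarith [sq_nonneg x])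
  have h0 : 0 ≤ (1 + x ^ 2)⁻¹ := by positivity
  rw [Real.norm_of_nonneg (by positivity)]
  nlinarith

theorem hasDerivAt_integral_mul_translate (Q : Lp ℂ 2 (volume : Measure ℝ)) (φ : 𝓢(ℝ, ℂ)) :
    HasDerivAt (fun s : ℝ => ∫ x, Q x * φ (x + s)) (∫ x, Q x * deriv φ x) 0 := by
  obtain ⟨C, hC⟩ := exists_norm_schwartz_add_le (derivCLM ℂ ℂ φ)
  have hmain := hasDerivAt_integral_of_dominated_loc_of_deriv_le (μ := volume)
    (F := fun s x => Q x * φ (x + s)) (F' := fun s x => Q x * derivCLM ℂ ℂ φ (x + s)) (x₀ := 0)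
    (s := Set.Ioo (-1 : ℝ) 1) (bound := fun x => C * (‖Q x‖ * (1 + x ^ 2)⁻¹))
    (Ioo_mem_nhds (by norm_num) (by norm_num)) ?_ ?_ ?_ ?_ ?_ ?_
  · have := hmain.2
    simpa using this
  · refine Filter.Eventually.of_forall fun s => (Lp.aestronglyMeasurable Q).mul ?_
    exact (φ.continuous.comp (continuous_id.add continuous_const)).aestronglyMeasurable
  · simpa using integrable_coeFn_mul (Lp.memLp Q) φ
  · refine (Lp.aestronglyMeasurable Q).mul ?_
    exact ((derivCLM ℂ ℂ φ).continuous.comp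
      (continuous_id.add continuous_const)).aestronglyMeasurable
  · refine Filter.Eventually.of_forall fun x s hs => ?_
    rw [norm_mul]
    calc ‖Q x‖ * ‖derivCLM ℂ ℂ φ (x + s)‖ ≤ ‖Q x‖ * (C * (1 + x ^ 2)⁻¹) := by
          gcongr; exact hC s hs x
      _ = _ := by ring
  · exact (((Lp.memLp Q).norm).integrable_mul memLp_inv_one_add_sq).const_mul C
  · refine Filter.Eventually.of_forall fun x s _ => ?_
    exact ((φ.hasDerivAt (x + s)).comp_const_add x s).const_mul (Q x)

/-- The stationary form of the equation satisfied by the profile of a wave of velocity one. -/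
theorem weak_profile_equation {ω : ℝ} {Q : Lp ℂ 2 (volume : Measure ℝ)}
    (hsol : IsWeakSolution (travelingWave ω 1 Q)) (φ : 𝓢(ℝ, ℂ)) :
    Complex.I * (∫ x, Q x * deriv φ x) - ω * ∫ x, Q x * φ x =
      (∫ x, Q x * sqrtNegLaplacian φ x) - ∫ x, Q x * ((‖Q x‖ ^ 3 : ℝ) : ℂ) * φ x := by
  have h1 := hsol φ 0
  have hu0 : ∀ x, travelingWave ω 1 Q 0 x = Q x := fun x => by simp [travelingWave]
  simp only [hu0] at h1
  have h2 : HasDerivAt (fun s : ℝ => Complex.I * ∫ x, travelingWave ω 1 Q s x * φ x)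
      (Complex.I * (∫ x, Q x * deriv φ x) - ω * ∫ x, Q x * φ x) 0 := by
    have hfun : (fun s : ℝ => Complex.I * ∫ x, travelingWave ω 1 Q s x * φ x) =
        fun s : ℝ => Complex.I * (Complex.exp (Complex.I * ω * s) * ∫ x, Q x * φ (x + s)) := by
      funext s
      congr 1
      -- The change of variable `x ↦ x - s` moves the translation from `Q`, which need not be
      -- differentiable, to the test function.
      rw [← integral_const_mul,
        ← integral_sub_right_eq_self
          (fun x => Complex.exp (Complex.I * ω * s) * (Q x * φ (x + s))) s]
      simp [travelingWave, mul_assoc]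
    rw [hfun]
    have hexp : HasDerivAt (fun s : ℝ => Complex.exp (Complex.I * ω * s)) (Complex.I * ω) 0 := by
      have := ((Complex.ofRealCLM.hasDerivAt (x := (0 : ℝ))).const_mul (Complex.I * ω)).cexp
      simpa using this
    have := (hexp.mul (hasDerivAt_integral_mul_translate Q φ)).const_mul Complex.I
    convert! this using 1
    simp
    linear_combination (-(ω : ℂ) * ∫ x, Q x * φ x) * Complex.I_mul_I
  exact h2.unique h1

/-! ### The profile equation on the Fourier side -/

theorem fourier_fourier_apply (ψ : 𝓢(ℝ, ℂ)) (ξ : ℝ) : (𝓕 (𝓕 ψ)) ξ = ψ (-ξ) := by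
  have h : (𝓕⁻ (𝓕 ψ)) (-ξ) = ψ (-ξ) := by simp
  rw [← h, fourierInv_coe, Real.fourierInv_eq_fourier_neg, neg_neg, fourier_coe]

theorem sqrtNegLaplacian_fourier (ψ : 𝓢(ℝ, ℂ)) :
    sqrtNegLaplacian (𝓕 ψ) = 𝓕 fun ξ : ℝ => ((|2 * Real.pi * ξ| : ℝ) : ℂ) * ψ ξ := by
  unfold sqrtNegLaplacian
  rw [Real.fourierInv_eq_fourier_comp_neg]
  congr 1
  funext ξ
  rw [fourier_fourier_apply]
  simp

/-- On a half-line `|ξ| = εξ` is smooth, so for `ψ` supported there `√(-Δ)` and the derivative of `𝓕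
ψ` are both multiples of one Schwartz function `𝓕 χ`, `χ = 2πξψ`. The corner of the symbol at 0 is
never met. -/
theorem fourier_profile_equation_of_sign {ω ε : ℝ} (hε : ε = 1 ∨ ε = -1)
    {Q F : Lp ℂ 2 (volume : Measure ℝ)}
    (hsol : IsWeakSolution (travelingWave ω 1 Q))
    (hF : F =ᵐ[volume] fun x => Q x * ((‖Q x‖ ^ 3 : ℝ) : ℂ)) :
    ∀ᵐ ξ : ℝ, ξ ∈ {ξ : ℝ | 0 < ε * ξ} →
      (𝓕 F : Lp ℂ 2 (volume : Measure ℝ)) ξ - ω * (𝓕 Q : Lp ℂ 2 (volume : Measure ℝ)) ξ +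
        ((1 - ε : ℝ) : ℂ) * (((2 * Real.pi * ξ : ℝ) : ℂ) *
          (𝓕 Q : Lp ℂ 2 (volume : Measure ℝ)) ξ) = 0 := by
  have hlin : LocallyIntegrable fun ξ : ℝ => ((2 * Real.pi * ξ : ℝ) : ℂ) *
      (𝓕 Q : Lp ℂ 2 (volume : Measure ℝ)) ξ := by
    rw [← locallyIntegrableOn_univ]
    exact (locallyIntegrableOn_univ.2 (locallyIntegrable_coeFn _)).continuousOn_mul
      (Continuous.continuousOn (by fun_prop)) isOpen_univ.isLocallyClosed
  have hconst : ∀ {f : ℝ → ℂ} (c : ℂ), LocallyIntegrable f →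
      LocallyIntegrable fun ξ => c * f ξ := fun c hf => hf.smul c
  refine IsOpen.ae_eq_zero_of_integral_contDiff_smul_eq_zero
    (isOpen_lt continuous_const (by fun_prop))
    ((((locallyIntegrable_coeFn _).sub (hconst _ (locallyIntegrable_coeFn _))).add
      (hconst _ hlin)).locallyIntegrableOn _) ?_
  intro g hg hgc hgU
  have hg₁ : HasCompactSupport (Complex.ofRealCLM ∘ g) := hgc.comp_left rfl
  have hg₂ : ContDiff ℝ (⊤ : ℕ∞) (Complex.ofRealCLM ∘ g) := by fun_prop
  let ψ : 𝓢(ℝ, ℂ) := hg₁.toSchwartzMap hg₂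
  have hψ : ∀ ξ, ψ ξ = g ξ := fun ξ => rfl
  have hgrowth : (fun ξ : ℝ => ((2 * Real.pi * ξ : ℝ) : ℂ)).HasTemperateGrowth := by fun_prop
  let χ : 𝓢(ℝ, ℂ) := smulLeftCLM ℂ (fun ξ : ℝ => ((2 * Real.pi * ξ : ℝ) : ℂ)) ψ
  have hχ : ∀ ξ, χ ξ = ((2 * Real.pi * ξ : ℝ) : ℂ) * ψ ξ := fun ξ => by
    simp only [χ]
    rw [smulLeftCLM_apply_apply hgrowth, smul_eq_mul]
  have hsqrt : ∀ x, sqrtNegLaplacian (𝓕 ψ) x = ε * (𝓕 χ) x := by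
    intro x
    have hfun : (fun ξ : ℝ => ((|2 * Real.pi * ξ| : ℝ) : ℂ) * ψ ξ) = (ε : ℂ) • (χ : ℝ → ℂ) := by
      funext ξ
      rw [Pi.smul_apply, hχ, smul_eq_mul]
      by_cases h : ξ ∈ tsupport g
      · have hpos : 0 < ε * ξ := hgU h
        have : |2 * Real.pi * ξ| = ε * (2 * Real.pi * ξ) := by
          have hpi := Real.pi_pos
          rcases hε with rfl | rfl
          · rw [one_mul] at hpos ⊢
            exact abs_of_pos (by positivity)
          · have : 0 < -ξ := by linarith
            rw [abs_of_neg (by nlinarith)]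
            ring
        rw [this]
        push_cast
        ring
      · have : ψ ξ = 0 := by rw [hψ, image_eq_zero_of_notMem_tsupport h]; simp
        simp [this]
    rw [sqrtNegLaplacian_fourier, hfun, fourier_coe, Real.fourier_eq, Real.fourier_eq,
      ← integral_const_mul]
    congr 1
    funext v
    simp only [Pi.smul_apply, Circle.smul_def, smul_eq_mul]
    ring
  have hderiv : ∀ x, deriv (𝓕 ψ : 𝓢(ℝ, ℂ)) x = -Complex.I * (𝓕 χ) x := by
    intro x
    have hx : Integrable fun x : ℝ => x • ψ x := by
      have := (χ.integrable (μ := volume)).const_mul ((2 * Real.pi : ℝ) : ℂ)⁻¹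
      refine this.congr (Filter.Eventually.of_forall fun ξ => ?_)
      simp only [hχ]
      push_cast
      have : (Real.pi : ℂ) ≠ 0 := by exact_mod_cast Real.pi_ne_zero
      field_simp
      simp
    rw [fourier_coe, Real.deriv_fourier ψ.integrable hx, fourier_coe, Real.fourier_eq,
      Real.fourier_eq, ← integral_const_mul]
    congr 1
    funext v
    simp only [Circle.smul_def, smul_eq_mul, hχ]
    push_cast
    ring
  have heq := weak_profile_equation hsol (𝓕 ψ)
  simp only [hsqrt, hderiv] at heq
  have e1 : ∫ x, Q x * (-Complex.I * (𝓕 χ) x) = -Complex.I * ∫ x, Q x * (𝓕 χ) x := by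
    rw [← integral_const_mul]; congr 1; funext x; ring
  have e2 : ∫ x, Q x * (ε * (𝓕 χ) x) = ε * ∫ x, Q x * (𝓕 χ) x := by
    rw [← integral_const_mul]; congr 1; funext x; ring
  have e3 : ∫ x, Q x * ((‖Q x‖ ^ 3 : ℝ) : ℂ) * (𝓕 ψ) x = ∫ x, F x * (𝓕 ψ) x := by
    apply integral_congr_ae
    filter_upwards [hF] with x hx
    rw [hx]
  rw [e1, e2, e3, ← integral_fourier_mul, ← integral_fourier_mul, ← integral_fourier_mul] at heq
  have hi1 := integrable_coeFn_mul (Lp.memLp (𝓕 F : Lp ℂ 2 (volume : Measure ℝ))) ψ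
  have hi2 := integrable_coeFn_mul (Lp.memLp (𝓕 Q : Lp ℂ 2 (volume : Measure ℝ))) ψ
  have hi3 := integrable_coeFn_mul (Lp.memLp (𝓕 Q : Lp ℂ 2 (volume : Measure ℝ))) χ
  calc ∫ x, g x • ((𝓕 F : Lp ℂ 2 (volume : Measure ℝ)) x -
        ω * (𝓕 Q : Lp ℂ 2 (volume : Measure ℝ)) x + ((1 - ε : ℝ) : ℂ) *
          (((2 * Real.pi * x : ℝ) : ℂ) * (𝓕 Q : Lp ℂ 2 (volume : Measure ℝ)) x))
      = ∫ x, ((𝓕 F : Lp ℂ 2 (volume : Measure ℝ)) x * ψ x -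
        ω * ((𝓕 Q : Lp ℂ 2 (volume : Measure ℝ)) x * ψ x)) +
        ((1 - ε : ℝ) : ℂ) * ((𝓕 Q : Lp ℂ 2 (volume : Measure ℝ)) x * χ x) := by
          congr 1
          funext x
          rw [hχ, hψ, Complex.real_smul]
          ring
    _ = (∫ x, (𝓕 F : Lp ℂ 2 (volume : Measure ℝ)) x * ψ x) -
        ω * (∫ x, (𝓕 Q : Lp ℂ 2 (volume : Measure ℝ)) x * ψ x) +
        ((1 - ε : ℝ) : ℂ) * ∫ x, (𝓕 Q : Lp ℂ 2 (volume : Measure ℝ)) x * χ x := by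
          have hi12 : Integrable fun x => (𝓕 F : Lp ℂ 2 (volume : Measure ℝ)) x * ψ x -
              ω * ((𝓕 Q : Lp ℂ 2 (volume : Measure ℝ)) x * ψ x) := hi1.sub (hi2.const_mul _)
          rw [integral_add hi12 (hi3.const_mul _),
            integral_sub hi1 (hi2.const_mul _), integral_const_mul, integral_const_mul]
    _ = 0 := by
          push_cast
          linear_combination heq +
            (∫ x, (𝓕 Q : Lp ℂ 2 (volume : Measure ℝ)) x * χ x) * Complex.I_mul_I

/-- The profile equation on the Fourier side: the symbol of `√(-Δ) - i ∂ₓ` vanishes on positive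
frequencies. -/
theorem fourier_profile_equation {ω : ℝ} {Q F : Lp ℂ 2 (volume : Measure ℝ)}
    (hsol : IsWeakSolution (travelingWave ω 1 Q))
    (hF : F =ᵐ[volume] fun x => Q x * ((‖Q x‖ ^ 3 : ℝ) : ℂ)) :
    (𝓕 (F - (ω : ℂ) • Q) : Lp ℂ 2 (volume : Measure ℝ)) =ᵐ[volume] fun ξ =>
      ((4 * Real.pi * max (-ξ) 0 : ℝ) : ℂ) * (𝓕 Q : Lp ℂ 2 (volume : Measure ℝ)) ξ := by
  have h0 : ∀ᵐ ξ : ℝ, ξ ≠ 0 := by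
    simp [ae_iff]
  have hlin : (𝓕 (F - (ω : ℂ) • Q) : Lp ℂ 2 (volume : Measure ℝ)) = 𝓕 F - (ω : ℂ) • 𝓕 Q := by
    have := (Lp.fourierTransformₗᵢ ℝ ℂ).map_sub F ((ω : ℂ) • Q)
    rw [map_smul] at this
    exact this
  rw [hlin]
  filter_upwards [h0, fourier_profile_equation_of_sign (Or.inl rfl) hsol hF,
    fourier_profile_equation_of_sign (Or.inr rfl) hsol hF,
    Lp.coeFn_sub (𝓕 F) ((ω : ℂ) • (𝓕 Q : Lp ℂ 2 (volume : Measure ℝ))),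
    Lp.coeFn_smul (ω : ℂ) (𝓕 Q : Lp ℂ 2 (volume : Measure ℝ))] with ξ h0 h1 h2 h3 h4
  rw [h3, Pi.sub_apply, h4, Pi.smul_apply, smul_eq_mul]
  rcases lt_or_gt_of_ne h0 with h | h
  · have := h2 (by simpa using h)
    rw [max_eq_left (by linarith)]
    push_cast at this ⊢
    linear_combination this
  · have := h1 (by simpa using h)
    rw [max_eq_right (by linarith)]
    push_cast at this ⊢
    linear_combination this

/-! ### Modulations and the vanishing of negative frequencies -/

/-- The modulation `x ↦ exp (2 π i s x) f x` of a square integrable function. -/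
noncomputable def modulation (s : ℝ) (f : Lp ℂ 2 (volume : Measure ℝ)) :
    Lp ℂ 2 (volume : Measure ℝ) :=
  (memLp_fourierChar_mul f s).toLp _

theorem coeFn_modulation (s : ℝ) (f : Lp ℂ 2 (volume : Measure ℝ)) :
    modulation s f =ᵐ[volume] fun x => ((Real.fourierChar (s * x) : Circle) : ℂ) * f x :=
  (memLp_fourierChar_mul f s).coeFn_toLp

theorem norm_fourierChar_sub_one_le (θ : ℝ) :
    ‖((Real.fourierChar θ : Circle) : ℂ) - 1‖ ≤ 2 * Real.pi * |θ| := by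
  rw [Real.fourierChar_apply, mul_comm _ Complex.I]
  refine (Real.norm_exp_I_mul_ofReal_sub_one_le).trans (le_of_eq ?_)
  rw [Real.norm_eq_abs, abs_mul, abs_of_pos Real.two_pi_pos]

theorem norm_fourierChar_sub_one_le_two (θ : ℝ) :
    ‖((Real.fourierChar θ : Circle) : ℂ) - 1‖ ≤ 2 := by
  refine (norm_sub_le _ _).trans ?_
  rw [Circle.norm_coe, norm_one]
  norm_num

theorem integrable_norm_sq_coeFn (f : Lp ℂ 2 (volume : Measure ℝ)) :
    Integrable fun x => ‖f x‖ ^ 2 :=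
  (memLp_two_iff_integrable_sq_norm (Lp.aestronglyMeasurable f)).1 (Lp.memLp f)

theorem tendsto_modulation (f : Lp ℂ 2 (volume : Measure ℝ)) :
    Filter.Tendsto (fun s => ‖modulation s f - f‖) (nhds 0) (nhds 0) := by
  have h2 : Filter.Tendsto (fun s => ‖modulation s f - f‖ ^ 2) (nhds 0) (nhds 0) := by
    have heq : ∀ s, ‖modulation s f - f‖ ^ 2 =
        ∫ x, (‖((Real.fourierChar (s * x) : Circle) : ℂ) - 1‖ * ‖f x‖) ^ 2 := by
      intro s
      rw [norm_sq_eq_integral]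
      apply integral_congr_ae
      filter_upwards [coeFn_modulation s f, Lp.coeFn_sub (modulation s f) f] with x h1 h2
      rw [h2, Pi.sub_apply, h1, ← norm_mul, sub_mul, one_mul]
    simp only [heq]
    have h0 : ∫ x, (‖((Real.fourierChar ((0 : ℝ) * x) : Circle) : ℂ) - 1‖ * ‖f x‖) ^ 2 = 0 := by
      simp
    suffices h : Filter.Tendsto
        (fun s => ∫ x, (‖((Real.fourierChar (s * x) : Circle) : ℂ) - 1‖ * ‖f x‖) ^ 2) (nhds 0)
        (nhds (∫ x, (‖((Real.fourierChar ((0 : ℝ) * x) : Circle) : ℂ) - 1‖ * ‖f x‖) ^ 2)) by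
      rwa [h0] at h
    refine tendsto_integral_filter_of_dominated_convergence (fun x => 4 * ‖f x‖ ^ 2)
      ?_ ?_ ((integrable_norm_sq_coeFn f).const_mul 4) ?_
    · refine Filter.Eventually.of_forall fun s => ?_
      exact ((Continuous.aestronglyMeasurable (by fun_prop)).mul
        (Lp.aestronglyMeasurable f).norm).pow 2
    · refine Filter.Eventually.of_forall fun s => Filter.Eventually.of_forall fun x => ?_
      rw [Real.norm_of_nonneg (by positivity), mul_pow]
      gcongr
      have := norm_fourierChar_sub_one_le_two (s * x)
      nlinarith [norm_nonneg (((Real.fourierChar (s * x) : Circle) : ℂ) - 1)]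
    · refine Filter.Eventually.of_forall fun x => ?_
      have hc : Continuous fun s : ℝ =>
          (‖((Real.fourierChar (s * x) : Circle) : ℂ) - 1‖ * ‖f x‖) ^ 2 := by fun_prop
      exact hc.tendsto 0
  have := h2.sqrt
  simpa [Real.sqrt_sq] using this

/-- The difference quotient of the negative part. -/
noncomputable def negPartQuotient (s ξ : ℝ) : ℝ := (max (-(ξ - s)) 0 - max (-ξ) 0) / s

theorem continuous_negPartQuotient (s : ℝ) : Continuous (negPartQuotient s) := by
  unfold negPartQuotient; fun_prop

theorem negPartQuotient_nonneg {s : ℝ} (hs : 0 < s) (ξ : ℝ) : 0 ≤ negPartQuotient s ξ := by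
  refine div_nonneg (sub_nonneg.2 (max_le_max ?_ le_rfl)) hs.le
  linarith

theorem negPartQuotient_le_one {s : ℝ} (hs : 0 < s) (ξ : ℝ) : negPartQuotient s ξ ≤ 1 := by
  rw [negPartQuotient, div_le_one hs, sub_le_iff_le_add]
  refine max_le ?_ ?_
  · linarith [le_max_left (-ξ) 0]
  · linarith [le_max_right (-ξ) 0]

theorem negPartQuotient_of_neg {s ξ : ℝ} (hs : 0 < s) (hξ : ξ < 0) : negPartQuotient s ξ = 1 := by
  rw [negPartQuotient, max_eq_left (by linarith), max_eq_left (by linarith)]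
  field_simp
  ring

/-- A real multiple of `Q` whose Fourier transform is the product of that of `Q` and a multiple of
the negative part of the frequency forces `Q` to have no negative frequencies. -/
theorem fourier_eq_zero_of_neg {Q W : Lp ℂ 2 (volume : Measure ℝ)} {r : ℝ → ℝ} {a : ℝ} (ha : a ≠ 0)
    (hW : W =ᵐ[volume] fun x => (r x : ℂ) * Q x)
    (hWF : (𝓕 W : Lp ℂ 2 (volume : Measure ℝ)) =ᵐ[volume] fun ξ =>
      ((a * max (-ξ) 0 : ℝ) : ℂ) * (𝓕 Q : Lp ℂ 2 (volume : Measure ℝ)) ξ) :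
    ∀ᵐ ξ : ℝ, ξ < 0 → (𝓕 Q : Lp ℂ 2 (volume : Measure ℝ)) ξ = 0 := by
  set q : Lp ℂ 2 (volume : Measure ℝ) := 𝓕 Q with hq
  -- By Plancherel both sides are integrals in `x`, equal because the factor `r` is real and
  -- commutes with the modulation.
  have hmod : ∀ s, inner ℂ q (𝓕 (modulation s W) : Lp ℂ 2 (volume : Measure ℝ)) =
      inner ℂ (𝓕 W : Lp ℂ 2 (volume : Measure ℝ)) (𝓕 (modulation s Q)) := by
    intro s
    rw [hq, Lp.inner_fourier_eq, Lp.inner_fourier_eq, L2.inner_def, L2.inner_def]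
    apply integral_congr_ae
    filter_upwards [hW, coeFn_modulation s W, coeFn_modulation s Q] with x h1 h2 h3
    rw [h2, h3, h1]
    simp only [RCLike.inner_apply, map_mul, Complex.conj_ofReal]
    ring
  have hKmem : ∀ s, 0 < s → MemLp (fun ξ => (negPartQuotient s ξ : ℂ) * q ξ) 2 := by
    intro s hs
    refine (Lp.memLp q).of_le ?_ (Filter.Eventually.of_forall fun ξ => ?_)
    · exact (Complex.continuous_ofReal.comp
        (continuous_negPartQuotient s)).aestronglyMeasurable.mul (Lp.aestronglyMeasurable q)
    · rw [norm_mul, Complex.norm_real, Real.norm_of_nonneg (negPartQuotient_nonneg hs ξ)]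
      exact mul_le_of_le_one_left (norm_nonneg _) (negPartQuotient_le_one hs ξ)
  have hbound : ∀ s, 0 < s → ∫ ξ in Set.Iio 0, ‖q ξ‖ ^ 2 ≤ ‖Q‖ * ‖modulation s Q - Q‖ := by
    intro s hs
    set K := (hKmem s hs).toLp _ with hK
    have hKae : K =ᵐ[volume] fun ξ => (negPartQuotient s ξ : ℂ) * q ξ := (hKmem s hs).coeFn_toLp
    -- Modulation shifts frequencies by `s`, so the two sides of `hmod` carry the symbol at `ξ - s`
    -- and at `ξ`; their difference is `a * s` times the quotient.
    have horth : inner ℂ K (𝓕 (modulation s Q) : Lp ℂ 2 (volume : Measure ℝ)) = 0 := by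
      have h1 := hmod s
      have hshift : ∀ᵐ ξ : ℝ, (𝓕 W : Lp ℂ 2 (volume : Measure ℝ)) (ξ - s) =
          ((a * max (-(ξ - s)) 0 : ℝ) : ℂ) * q (ξ - s) :=
        (measurePreserving_sub_right volume s).quasiMeasurePreserving.ae hWF
      have h2 : ((a * s : ℝ) : ℂ) * inner ℂ K (𝓕 (modulation s Q) : Lp ℂ 2 (volume : Measure ℝ)) =
          inner ℂ q (𝓕 (modulation s W) : Lp ℂ 2 (volume : Measure ℝ)) -
          inner ℂ (𝓕 W : Lp ℂ 2 (volume : Measure ℝ)) (𝓕 (modulation s Q)) := by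
        rw [L2.inner_def, L2.inner_def, L2.inner_def, ← integral_const_mul,
          ← integral_sub (L2.integrable_inner _ _) (L2.integrable_inner _ _)]
        apply integral_congr_ae
        filter_upwards [hKae, hWF, hshift, fourier_modulation (coeFn_modulation s W),
          fourier_modulation (coeFn_modulation s Q)] with ξ h1 h2 h3 h4 h5
        rw [h1, h2, h4, h5, h3]
        have hk : a * s * negPartQuotient s ξ = a * max (-(ξ - s)) 0 - a * max (-ξ) 0 := by
          unfold negPartQuotient; field_simp
        have hk' := congrArg (fun t : ℝ => (t : ℂ)) hk
        simp only [Complex.ofReal_sub] at hk'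
        simp only [RCLike.inner_apply, map_mul, Complex.conj_ofReal]
        rw [Complex.ofReal_mul] at hk'
        linear_combination (q (ξ - s) * (starRingEnd ℂ) (q ξ)) * hk'
      rw [h1, sub_self] at h2
      refine (mul_eq_zero.1 h2).resolve_left ?_
      exact_mod_cast mul_ne_zero ha hs.ne'
    have hKq : inner ℂ K q = ((∫ ξ, negPartQuotient s ξ * ‖q ξ‖ ^ 2 : ℝ) : ℂ) := by
      rw [L2.inner_def, ← integral_complex_ofReal]
      apply integral_congr_ae
      filter_upwards [hKae] with ξ h1
      rw [h1]
      simp only [RCLike.inner_apply, map_mul, Complex.conj_ofReal]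
      have := Complex.mul_conj' (q ξ)
      push_cast
      linear_combination (negPartQuotient s ξ : ℂ) * this
    have hKnorm : ‖K‖ ≤ ‖q‖ := by
      apply Lp.norm_le_norm_of_ae_le
      filter_upwards [hKae] with ξ h1
      rw [h1, norm_mul, Complex.norm_real, Real.norm_of_nonneg (negPartQuotient_nonneg hs ξ)]
      exact mul_le_of_le_one_left (norm_nonneg _) (negPartQuotient_le_one hs ξ)
    have hqQ : ‖q‖ = ‖Q‖ := Lp.norm_fourier_eq Q
    have hdiff : ‖q - 𝓕 (modulation s Q)‖ = ‖modulation s Q - Q‖ := by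
      rw [norm_sub_rev, hq]
      have := (Lp.fourierTransformₗᵢ ℝ ℂ).map_sub (modulation s Q) Q
      have h2 := (Lp.fourierTransformₗᵢ ℝ ℂ).norm_map (modulation s Q - Q)
      rw [this] at h2
      exact h2
    have hint : Integrable fun ξ => negPartQuotient s ξ * ‖q ξ‖ ^ 2 := by
      refine (integrable_norm_sq_coeFn q).mono' ?_ (Filter.Eventually.of_forall fun ξ => ?_)
      · exact (continuous_negPartQuotient s).aestronglyMeasurable.mul
          ((Lp.aestronglyMeasurable q).norm.pow 2)
      · rw [Real.norm_of_nonneg (mul_nonneg (negPartQuotient_nonneg hs ξ) (by positivity))]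
        exact mul_le_of_le_one_left (by positivity) (negPartQuotient_le_one hs ξ)
    -- The quotient equals 1 on `ξ < 0` and is nonnegative elsewhere. Orthogonality then allows
    -- replacing `q` by `q - 𝓕 (modulation s Q)`, which is small.
    calc ∫ ξ in Set.Iio 0, ‖q ξ‖ ^ 2
        = ∫ ξ in Set.Iio 0, negPartQuotient s ξ * ‖q ξ‖ ^ 2 := by
          apply setIntegral_congr_fun measurableSet_Iio
          intro ξ hξ
          simp only [negPartQuotient_of_neg hs hξ, one_mul]
      _ ≤ ∫ ξ, negPartQuotient s ξ * ‖q ξ‖ ^ 2 :=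
          setIntegral_le_integral hint (Filter.Eventually.of_forall fun ξ =>
            mul_nonneg (negPartQuotient_nonneg hs ξ) (by positivity))
      _ ≤ ‖inner ℂ K q‖ := by
          rw [hKq, Complex.norm_real]; exact le_abs_self _
      _ = ‖inner ℂ K (q - 𝓕 (modulation s Q))‖ := by rw [inner_sub_right, horth, sub_zero]
      _ ≤ ‖K‖ * ‖q - 𝓕 (modulation s Q)‖ := norm_inner_le_norm _ _
      _ ≤ ‖Q‖ * ‖modulation s Q - Q‖ := by rw [hdiff]; gcongr; exact hKnorm.trans hqQ.le
  have hlim : Filter.Tendsto (fun s => ‖Q‖ * ‖modulation s Q - Q‖) (nhdsWithin 0 (Set.Ioi 0))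
      (nhds 0) := by
    have := ((tendsto_modulation Q).const_mul ‖Q‖).mono_left
      (nhdsWithin_le_nhds (s := Set.Ioi (0 : ℝ)))
    simpa using this
  have hle : ∫ ξ in Set.Iio 0, ‖q ξ‖ ^ 2 ≤ 0 :=
    ge_of_tendsto hlim (eventually_mem_nhdsWithin.mono fun s hs => hbound s hs)
  have hzero : ∫ ξ in Set.Iio 0, ‖q ξ‖ ^ 2 = 0 :=
    le_antisymm hle (integral_nonneg fun ξ => by positivity)
  rw [integral_eq_zero_iff_of_nonneg (fun ξ => by positivity)
    (integrable_norm_sq_coeFn q).integrableOn] at hzero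
  have := (ae_restrict_iff' measurableSet_Iio).1 hzero
  filter_upwards [this] with ξ h hξ
  simpa using h hξ

/-- The profile of a wave of velocity one solves `Q |Q|³ = ω Q`. -/
theorem nonlinearity_eq {ω : ℝ} {Q : Lp ℂ 2 (volume : Measure ℝ)} (hQ : MemHHalf Q)
    (hsol : IsWeakSolution (travelingWave ω 1 Q)) :
    ∀ᵐ x, Q x * ((‖Q x‖ ^ 3 : ℝ) : ℂ) = ω * Q x := by
  set F := (memLp_nonlinearity hQ).toLp _ with hFdef
  have hF : F =ᵐ[volume] fun x => Q x * ((‖Q x‖ ^ 3 : ℝ) : ℂ) := (memLp_nonlinearity hQ).coeFn_toLp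
  set W := F - (ω : ℂ) • Q with hWdef
  have hW : W =ᵐ[volume] fun x => ((‖Q x‖ ^ 3 - ω : ℝ) : ℂ) * Q x := by
    filter_upwards [hF, Lp.coeFn_sub F ((ω : ℂ) • Q), Lp.coeFn_smul (ω : ℂ) Q] with x h1 h2 h3
    rw [hWdef, h2, Pi.sub_apply, h3, h1, Pi.smul_apply, smul_eq_mul]
    push_cast
    ring
  have hWF := fourier_profile_equation hsol hF
  have hneg := fourier_eq_zero_of_neg (a := 4 * Real.pi) (by positivity) hW hWF
  -- Negative frequencies vanish by `hneg`, the others because the symbol is zero there.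
  have hW0 : (𝓕 W : Lp ℂ 2 (volume : Measure ℝ)) = 0 := by
    rw [Lp.eq_zero_iff_ae_eq_zero]
    filter_upwards [hWF, hneg] with ξ h1 h2
    rw [h1]
    rcases lt_or_ge ξ 0 with h | h
    · rw [h2 h, mul_zero, Pi.zero_apply]
    · rw [max_eq_right (by linarith)]; simp
  have hW0' : W = 0 := by
    have := Lp.norm_fourier_eq W
    rw [hW0, norm_zero] at this
    exact norm_eq_zero.1 this.symm
  rw [Lp.eq_zero_iff_ae_eq_zero] at hW0'
  filter_upwards [hW, hW0'] with x h1 h2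
  rw [h1, Pi.zero_apply] at h2
  push_cast at h2 ⊢
  linear_combination h2

/-! ### Translations and rigidity of a two-valued modulus -/

theorem memLp_translate (f : Lp ℂ 2 (volume : Measure ℝ)) (h : ℝ) :
    MemLp (fun x => f (x + h)) 2 :=
  (Lp.memLp f).comp_measurePreserving (measurePreserving_add_right volume h)

/-- The translate `x ↦ f (x + h)` of a square integrable function. -/
noncomputable def translate (h : ℝ) (f : Lp ℂ 2 (volume : Measure ℝ)) :
    Lp ℂ 2 (volume : Measure ℝ) :=
  (memLp_translate f h).toLp _

theorem coeFn_translate (h : ℝ) (f : Lp ℂ 2 (volume : Measure ℝ)) :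
    translate h f =ᵐ[volume] fun x => f (x + h) :=
  (memLp_translate f h).coeFn_toLp

theorem norm_translate_sub_sq (h : ℝ) (f : Lp ℂ 2 (volume : Measure ℝ)) :
    ‖translate h f - f‖ ^ 2 = ∫ ξ, (‖((Real.fourierChar (h * ξ) : Circle) : ℂ) - 1‖ *
      ‖(𝓕 f : Lp ℂ 2 (volume : Measure ℝ)) ξ‖) ^ 2 := by
  have h1 : ‖translate h f - f‖ =
      ‖(𝓕 (translate h f) : Lp ℂ 2 (volume : Measure ℝ)) - 𝓕 f‖ := by
    have := (Lp.fourierTransformₗᵢ ℝ ℂ).map_sub (translate h f) f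
    have h2 := (Lp.fourierTransformₗᵢ ℝ ℂ).norm_map (translate h f - f)
    rw [this] at h2
    exact h2.symm
  rw [h1, norm_sq_eq_integral]
  apply integral_congr_ae
  filter_upwards [fourier_translation (coeFn_translate h f),
    Lp.coeFn_sub (𝓕 (translate h f)) (𝓕 f)] with ξ h1 h2
  rw [h2, Pi.sub_apply, h1, ← norm_mul, sub_mul, one_mul]

theorem integrable_abs_mul_fourier_sq {Q : Lp ℂ 2 (volume : Measure ℝ)} (hQ : MemHHalf Q) :
    Integrable fun ξ : ℝ => |ξ| * ‖(𝓕 Q : Lp ℂ 2 (volume : Measure ℝ)) ξ‖ ^ 2 := by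
  have h := memLp_weight_mul_fourier hQ
  have h2 := (memLp_two_iff_integrable_sq_norm h.1).1 h
  refine h2.mono' ?_ (Filter.Eventually.of_forall fun ξ => ?_)
  · exact (Continuous.aestronglyMeasurable (by fun_prop)).mul
      ((Lp.aestronglyMeasurable _).norm.pow 2)
  · rw [Real.norm_of_nonneg (by positivity), norm_mul, mul_pow, Complex.norm_real,
      Real.norm_of_nonneg (by positivity)]
    gcongr
    rw [← Real.rpow_mul_natCast (by positivity)]
    have e : (1 / 4 : ℝ) * ((2 : ℕ) : ℝ) = 1 / 2 := by norm_num
    rw [e, ← Real.sqrt_eq_rpow]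
    apply Real.le_sqrt_of_sq_le
    rw [sq_abs]
    linarith

/-- Translations of a function in `H^{1/2}(ℝ)` satisfy `‖Q(· + h) - Q‖² = o(h)`. -/
theorem tendsto_mul_norm_translate_sub_sq {Q : Lp ℂ 2 (volume : Measure ℝ)} (hQ : MemHHalf Q) :
    Filter.Tendsto (fun n : ℕ => ((n : ℝ) + 1) * ‖translate (1 / ((n : ℝ) + 1)) Q - Q‖ ^ 2)
      Filter.atTop (nhds 0) := by
  set q : Lp ℂ 2 (volume : Measure ℝ) := 𝓕 Q with hq
  have heq : ∀ n : ℕ, ((n : ℝ) + 1) * ‖translate (1 / ((n : ℝ) + 1)) Q - Q‖ ^ 2 =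
      ∫ ξ, ((n : ℝ) + 1) * (‖((Real.fourierChar (1 / ((n : ℝ) + 1) * ξ) : Circle) : ℂ) - 1‖ *
        ‖q ξ‖) ^ 2 := fun n => by
    rw [norm_translate_sub_sq, integral_const_mul]
  simp only [heq]
  have h0 : ∫ _ : ℝ, (0 : ℝ) = 0 := by simp
  rw [← h0]
  refine tendsto_integral_of_dominated_convergence
    (fun ξ => (4 * Real.pi) * (|ξ| * ‖q ξ‖ ^ 2)) ?_
    ((integrable_abs_mul_fourier_sq hQ).const_mul _) ?_ ?_
  · intro n
    exact (((Continuous.aestronglyMeasurable (by fun_prop)).mul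
      (Lp.aestronglyMeasurable q).norm).pow 2).const_mul _
  · intro n
    refine Filter.Eventually.of_forall fun ξ => ?_
    have hn : (0 : ℝ) < (n : ℝ) + 1 := by positivity
    have hb1 := norm_fourierChar_sub_one_le (1 / ((n : ℝ) + 1) * ξ)
    have hb2 := norm_fourierChar_sub_one_le_two (1 / ((n : ℝ) + 1) * ξ)
    set z := ‖((Real.fourierChar (1 / ((n : ℝ) + 1) * ξ) : Circle) : ℂ) - 1‖ with hz
    have hz0 : 0 ≤ z := norm_nonneg _
    rw [Real.norm_of_nonneg (by positivity), mul_pow, ← mul_assoc, ← mul_assoc]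
    refine mul_le_mul_of_nonneg_right ?_ (sq_nonneg _)
    rw [abs_mul, abs_of_pos (by positivity : (0 : ℝ) < 1 / ((n : ℝ) + 1))] at hb1
    -- One factor `z` is bounded by 2 and the other linearly in the frequency: this costs just one
    -- power of `|ξ|`, which `H^{1/2}` can afford.
    calc ((n : ℝ) + 1) * z ^ 2 = ((n : ℝ) + 1) * (z * z) := by ring
      _ ≤ ((n : ℝ) + 1) * (2 * (2 * Real.pi * (1 / ((n : ℝ) + 1) * |ξ|))) := by gcongr
      _ = 4 * Real.pi * |ξ| := by field_simp; ring
  · refine Filter.Eventually.of_forall fun ξ => ?_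
    -- At fixed `ξ` the linear bound is used for both factors, which gains `1 / (n + 1)`.
    have hlim : Filter.Tendsto (fun n : ℕ => (2 * Real.pi * |ξ| * ‖q ξ‖) ^ 2 *
        (1 / ((n : ℝ) + 1))) Filter.atTop (nhds 0) := by
      have := (tendsto_one_div_add_atTop_nhds_zero_nat (𝕜 := ℝ)).const_mul
        ((2 * Real.pi * |ξ| * ‖q ξ‖) ^ 2)
      rwa [mul_zero] at this
    refine squeeze_zero (fun n => by positivity) (fun n => ?_) hlim
    have hn : (0 : ℝ) < (n : ℝ) + 1 := by positivity
    have hb1 := norm_fourierChar_sub_one_le (1 / ((n : ℝ) + 1) * ξ)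
    rw [abs_mul, abs_of_pos (by positivity : (0 : ℝ) < 1 / ((n : ℝ) + 1))] at hb1
    calc ((n : ℝ) + 1) * (‖((Real.fourierChar (1 / ((n : ℝ) + 1) * ξ) : Circle) : ℂ) - 1‖ *
        ‖q ξ‖) ^ 2 ≤ ((n : ℝ) + 1) * (2 * Real.pi * (1 / ((n : ℝ) + 1) * |ξ|) * ‖q ξ‖) ^ 2 := by
          gcongr
      _ = _ := by field_simp

/-- The `L¹` norm of an increment of the modulus of `Q`. -/
noncomputable def modulusIncrement (Q : ℝ → ℂ) (h : ℝ) : ENNReal :=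
  ∫⁻ x, ENNReal.ofReal |‖Q (x + h)‖ - ‖Q x‖|

theorem modulusIncrement_add_le {Q : ℝ → ℂ} (hQ : AEStronglyMeasurable Q) (h k : ℝ) :
    modulusIncrement Q (h + k) ≤ modulusIncrement Q h + modulusIncrement Q k := by
  have hm : ∀ a : ℝ, AEStronglyMeasurable (fun x => Q (x + a)) volume := fun a =>
    hQ.comp_measurePreserving (measurePreserving_add_right volume a)
  have hshift : modulusIncrement Q h =
      ∫⁻ x, ENNReal.ofReal |‖Q (x + (h + k))‖ - ‖Q (x + k)‖| := by
    rw [modulusIncrement, ← lintegral_add_right_eq_self _ k]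
    simp only [add_assoc, add_comm k h]
  rw [hshift, modulusIncrement, modulusIncrement, ← lintegral_add_left']
  · apply lintegral_mono
    intro x
    beta_reduce
    rw [← ENNReal.ofReal_add (abs_nonneg _) (abs_nonneg _)]
    exact ENNReal.ofReal_le_ofReal (abs_sub_le _ _ _)
  · have := ((hm (h + k)).norm.sub (hm k).norm).norm.aemeasurable.ennreal_ofReal
    simpa [Real.norm_eq_abs] using this

theorem modulusIncrement_nat_mul_le {Q : ℝ → ℂ} (hQ : AEStronglyMeasurable Q) (n : ℕ) (h : ℝ) :
    modulusIncrement Q (n * h) ≤ n * modulusIncrement Q h := by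
  induction n with
  | zero => simp [modulusIncrement]
  | succ n ih =>
    push_cast
    rw [add_mul, add_mul, one_mul, one_mul]
    exact (modulusIncrement_add_le hQ _ _).trans (by gcongr)

/-- An increment of a modulus with values in `{0, c}` is 0 or `±c`, so `c` times its absolute value
is its square. This turns an `L²` bound quadratic in the increment into an `L¹` bound, which is
subadditive in `h`. -/
theorem mul_modulusIncrement_le {Q : Lp ℂ 2 (volume : Measure ℝ)} {c : ℝ} (hc : 0 ≤ c)
    (hQc : ∀ᵐ x, ‖Q x‖ = 0 ∨ ‖Q x‖ = c) (h : ℝ) :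
    ENNReal.ofReal c * modulusIncrement Q h ≤ ENNReal.ofReal (‖translate h Q - Q‖ ^ 2) := by
  rw [norm_sq_eq_integral, ofReal_integral_eq_lintegral_ofReal (integrable_norm_sq_coeFn _)
    (Filter.Eventually.of_forall fun x => by positivity), modulusIncrement,
    ← lintegral_const_mul' _ _ ENNReal.ofReal_ne_top]
  apply lintegral_mono_ae
  have hQc' : ∀ᵐ x, ‖Q (x + h)‖ = 0 ∨ ‖Q (x + h)‖ = c :=
    (measurePreserving_add_right volume h).quasiMeasurePreserving.ae hQc
  filter_upwards [hQc, hQc', coeFn_translate h Q, Lp.coeFn_sub (translate h Q) Q] with x h1 h2 h3 h4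
  rw [h4, Pi.sub_apply, h3, ← ENNReal.ofReal_mul hc]
  apply ENNReal.ofReal_le_ofReal
  have hle := abs_norm_sub_norm_le (Q (x + h)) (Q x)
  have hsq : c * |‖Q (x + h)‖ - ‖Q x‖| = |‖Q (x + h)‖ - ‖Q x‖| ^ 2 := by
    rw [sq_abs]
    rcases h1 with h1 | h1 <;> rcases h2 with h2 | h2 <;> rw [h1, h2] <;>
      simp [abs_of_nonneg hc] <;> ring
  rw [hsq]
  gcongr

/-- A function in `H^{1/2}(ℝ)` whose modulus takes a single nonzero value vanishes. -/
theorem eq_zero_of_norm_eq {Q : Lp ℂ 2 (volume : Measure ℝ)} (hQ : MemHHalf Q) {c : ℝ} (hc : 0 ≤ c)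
    (hQc : ∀ᵐ x, ‖Q x‖ = 0 ∨ ‖Q x‖ = c) : Q = 0 := by
  rcases hc.eq_or_lt with rfl | hc'
  · rw [Lp.eq_zero_iff_ae_eq_zero]
    filter_upwards [hQc] with x hx
    simpa using hx
  have hzero : modulusIncrement Q 1 = 0 := by
    have hle : ∀ n : ℕ, ENNReal.ofReal c * modulusIncrement Q 1 ≤
        ENNReal.ofReal (((n : ℝ) + 1) * ‖translate (1 / ((n : ℝ) + 1)) Q - Q‖ ^ 2) := by
      intro n
      have h1 := modulusIncrement_nat_mul_le (Lp.aestronglyMeasurable Q) (n + 1) (1 / ((n : ℝ) + 1))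
      have e : ((n + 1 : ℕ) : ℝ) * (1 / ((n : ℝ) + 1)) = 1 := by push_cast; field_simp
      have e' : ((n + 1 : ℕ) : ENNReal) = ENNReal.ofReal ((n : ℝ) + 1) := by
        rw [← ENNReal.ofReal_natCast]; push_cast; rfl
      rw [e, e'] at h1
      rw [ENNReal.ofReal_mul (by positivity)]
      calc ENNReal.ofReal c * modulusIncrement Q 1
          ≤ ENNReal.ofReal c * (ENNReal.ofReal ((n : ℝ) + 1) *
              modulusIncrement Q (1 / ((n : ℝ) + 1))) := by gcongr
        _ = ENNReal.ofReal ((n : ℝ) + 1) *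
              (ENNReal.ofReal c * modulusIncrement Q (1 / ((n : ℝ) + 1))) := by ring
        _ ≤ _ := by gcongr; exact mul_modulusIncrement_le hc hQc _
    have hlim := ENNReal.tendsto_ofReal (tendsto_mul_norm_translate_sub_sq hQ)
    rw [ENNReal.ofReal_zero] at hlim
    have h0 : ENNReal.ofReal c * modulusIncrement Q 1 ≤ 0 :=
      ge_of_tendsto hlim (Filter.Eventually.of_forall hle)
    exact (mul_eq_zero.1 (le_antisymm h0 bot_le)).resolve_left (by simpa using hc')
  have hper : ∀ᵐ x, ‖Q (x + 1)‖ = ‖Q x‖ := by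
    have hm : AEStronglyMeasurable (fun x => Q (x + 1)) volume := (memLp_translate Q 1).1
    have hmeas : AEMeasurable (fun x => ENNReal.ofReal |‖Q (x + 1)‖ - ‖Q x‖|) volume := by
      have := (hm.norm.sub (Lp.aestronglyMeasurable Q).norm).norm.aemeasurable.ennreal_ofReal
      simpa [Real.norm_eq_abs] using this
    rw [modulusIncrement, lintegral_eq_zero_iff' hmeas] at hzero
    filter_upwards [hzero] with x hx
    simpa [sub_eq_zero] using hx
  have hPmem : MemLp (fun x => (‖Q x‖ : ℂ)) 2 := (Lp.memLp Q).norm.ofReal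
  set P := hPmem.toLp _ with hP
  have hPae : P =ᵐ[volume] fun x => (‖Q x‖ : ℂ) := hPmem.coeFn_toLp
  have hPtr : P =ᵐ[volume] fun x => P (x + 1) := by
    have hshift : ∀ᵐ x, P (x + 1) = (‖Q (x + 1)‖ : ℂ) :=
      (measurePreserving_add_right volume 1).quasiMeasurePreserving.ae hPae
    filter_upwards [hPae, hshift, hper] with x h1 h2 h3
    rw [h1, h2, h3]
  have hF := fourier_translation hPtr
  have hint : ∀ᵐ ξ : ℝ, ξ ∉ Set.range ((↑) : ℤ → ℝ) :=
    (Set.countable_range ((↑) : ℤ → ℝ)).ae_notMem volume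
  have hP0 : (𝓕 P : Lp ℂ 2 (volume : Measure ℝ)) = 0 := by
    rw [Lp.eq_zero_iff_ae_eq_zero]
    filter_upwards [hF, hint] with ξ h1 h2
    -- Periodicity gives `exp(2πiξ) P̂ = P̂`, so `P̂` lives on the integers, a null set.
    by_contra hne
    have h3 : ((Real.fourierChar (1 * ξ) : Circle) : ℂ) = 1 := by
      rw [Pi.zero_apply] at hne
      exact mul_right_cancel₀ hne (h1.symm.trans (one_mul _).symm)
    rw [one_mul, Real.fourierChar_apply, Complex.exp_eq_one_iff] at h3
    obtain ⟨n, hn⟩ := h3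
    refine h2 ⟨n, ?_⟩
    have hpi : (Real.pi : ℂ) ≠ 0 := by exact_mod_cast Real.pi_ne_zero
    have h4 : (2 * Real.pi * Complex.I) * (n : ℂ) = (2 * Real.pi * Complex.I) * (ξ : ℂ) := by
      push_cast at hn
      linear_combination -hn
    have h5 := mul_left_cancel₀ (by simp [hpi]) h4
    exact_mod_cast h5
  have hP0' : P = 0 := by
    have := Lp.norm_fourier_eq P
    rw [hP0, norm_zero] at this
    exact norm_eq_zero.1 this.symm
  rw [Lp.eq_zero_iff_ae_eq_zero] at hP0' ⊢
  filter_upwards [hPae, hP0'] with x h1 h2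
  rw [h1] at h2
  simpa using h2

end HalfWave

theorem theorem2 (ω : ℝ) :
    ¬ ∃ Q : Lp ℂ 2 (volume : Measure ℝ),
      HalfWave.MemHHalf Q ∧ Q ≠ 0 ∧ HalfWave.IsWeakSolution (HalfWave.travelingWave ω 1 Q) := by
  rintro ⟨Q, hQ, hne, hsol⟩
  -- The absolute value makes `c` nonnegative before the sign of `ω` is known; where `Q x ≠ 0`, `ω =
  -- ‖Q x‖ ^ 3` is itself nonnegative.
  refine hne (HalfWave.eq_zero_of_norm_eq hQ (c := |ω| ^ (1 / 3 : ℝ)) (by positivity) ?_)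
  filter_upwards [HalfWave.nonlinearity_eq hQ hsol] with x hx
  by_cases h : Q x = 0
  · left; simp [h]
  · right
    have h1 : ‖Q x‖ ^ 3 = ω := by
      rw [mul_comm (ω : ℂ)] at hx
      exact_mod_cast mul_left_cancel₀ h hx
    rw [← h1, abs_of_nonneg (by positivity), ← Real.rpow_natCast_mul (norm_nonneg _)]
    norm_num
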